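/- Let $d\ge 1$ and $a\in[0,1]$. Let $U(a)$ be the $2d\times 2d$ generalized Grover matrix, $U(a)_{ij}=\left(\frac{2}{2d}-1\right)a+1-\delta_{ij}$, and let $U^{(f)}(a)=(I_d\otimes\sigma)\,U(a)$ with $\sigma=\begin{bmatrix}0&1\\1&0\end{bmatrix}$ be its flip-flop version. For $N\ge 1$ let $T_N^d=(\mathbb Z/N\mathbb Z)^d$ with standard basis $e_1,\dots,e_d$, let $(\tau_jf)(x)=f(x-e_j)$, let $P_i$ be the projection of $\mathbb C^{2d}$ onto the $i$-th coordinate axis, and for a $2d\times2d$ matrix $A$ let $$M_A=\sum_{j=1}^d\left(P_{2j-1}A\,\tau_j^{-1}+P_{2j}A\,\tau_j\right),$$ a $2dN^d\times 2dN^d$ matrix. The walk-type zeta function is $$\overline\zeta(A,T_N^d,u)=\det\left(I_{2dN^d}-uM_A\right)^{-1/N^d},$$ where the power is the branch obtained by continuation along the segment from $0$ to $u$, starting from the value $1$ at $u=0$. Put $\kappa=2d-1+2(1-d)a$ (so $\kappa\ge 1$) and, for $w\in\mathbb R^d$ and $u\in\mathbb C$, $$F^{(f)}(w,u,a)=1-\frac{2(d+(1-d)a)}{d}\left(\sum_{j=1}^d\cos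 w_j\right)u+\left\{2d-1+2(1-d)a\right\}u^2 .$$ Let $\widetilde{\mathbb K}_N=\{0,2\pi/N,\dots,2\pi(N-1)/N\}$, let $\log$ be the principal logarithm, and let $$\Omega=\{u\in\mathbb C:\kappa|u|^2<1\}\setminus\{u\in\mathbb R:\kappa|u|\ge 1\},$$ which is star-shaped about $0$ and contains the disc $|u|<1/\kappa$. (1) For all $u\in\Omega$ and all $N\ge1$, $\det(I-uM_{U^{(f)}(a)})\ne0$, $F^{(f)}(\widetilde k,u,a)\neq0$ for all $\widetilde k\in\widetilde{\mathbb K}_N^d$, and $$\overline\zeta\left(U^{(f)}(a),T_N^d,u\right)^{-1}=(1-u^2)^{d-1}\exp\left[\frac1{N^d}\sum_{\widetilde k\in\widetilde{\mathbb K}_N^d}\log F^{(f)}(\widetilde k,u,a)\right].$$ Moreover, for every $N\ge 1$ and every $u\in\mathbb C$ such that $F^{(f)}(\widetilde k,u,a)\ne0$ for all $\widetilde k\in\widetilde{\mathbb K}_N^d$, the $N^d$-th power of the right-hand side equals $\det(I-uM_{U^{(f)}(a)})$. (2) For all $u\in\Omega$, $F^{(f)}(\theta,u,a)\ne0$ for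 all $\theta\in\mathbb R^d$, the function $\theta\mapsto\log F^{(f)}(\theta,u,a)$ is integrable on $[0,2\pi)^d$, and $$\lim_{N\to\infty}\overline\zeta\left(U^{(f)}(a),T_N^d,u\right)^{-1}=(1-u^2)^{d-1}\exp\left[\int_{[0,2\pi)^d}\log F^{(f)}(\theta,u,a)\,\frac{d\theta_1}{2\pi}\cdots\frac{d\theta_d}{2\pi}\right].$$ -/

import Mathlib

open scoped Kronecker Matrix

noncomputable section

/-- The vertex set of the `d`-dimensional torus `T_N^d = (ℤ mod N)^d`. -/
abbrev Torus (d N : ℕ) : Type := Fin d → ZMod N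

/-- The index set `{1, …, 2d}` of coin states: `(j, 0)` is the state `2j-1` and `(j, 1)` the
state `2j`. -/
abbrev CoinIdx (d : ℕ) : Type := Fin d × Fin 2

/-- The generalized Grover matrix `U(a)` of size `card ι`. -/
def generalizedGrover (ι : Type) [Fintype ι] [DecidableEq ι] (a : ℝ) : Matrix ι ι ℂ :=
  Matrix.of fun i j =>
    ((2 / (Fintype.card ι : ℂ) - 1) * (a : ℂ) + 1) - (if i = j then 1 else 0)

/-- The flip matrix `σ`. -/
def flipMatrix : Matrix (Fin 2) (Fin 2) ℂ := !![0, 1; 1, 0]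

/-- The flip-flop type coin matrix `A^{(f)} = (I_d ⊗ σ) A`. -/
def flipFlop {d : ℕ} (A : Matrix (CoinIdx d) (CoinIdx d) ℂ) :
    Matrix (CoinIdx d) (CoinIdx d) ℂ :=
  ((1 : Matrix (Fin d) (Fin d) ℂ) ⊗ₖ flipMatrix) * A

/-- The orthogonal projection onto the line spanned by the standard basis vector `i`. -/
def coinProj {d : ℕ} (i : CoinIdx d) : Matrix (CoinIdx d) (CoinIdx d) ℂ :=
  Matrix.single i i 1

/-- The matrix of the translation `f ↦ (x ↦ f (x - v))` of functions on the torus. -/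
def translation {d N : ℕ} (v : Torus d N) : Matrix (Torus d N) (Torus d N) ℂ :=
  Matrix.of fun x y => if y = x - v then 1 else 0

/-- The standard basis vector `e_j` of the torus; `translation (torusBasis j)` is the shift `τ_j`
and `translation (-torusBasis j)` is its inverse. -/
def torusBasis {d N : ℕ} (j : Fin d) : Torus d N := Pi.single j 1

/-- The time evolution `M_A = ∑_j (P_{2j-1} A τ_j⁻¹ + P_{2j} A τ_j)`, a matrix of size `2d N^d`. -/
def walkMatrix {d : ℕ} (N : ℕ) (A : Matrix (CoinIdx d) (CoinIdx d) ℂ) :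
    Matrix (Torus d N × CoinIdx d) (Torus d N × CoinIdx d) ℂ :=
  ∑ j : Fin d,
    (translation (-torusBasis j) ⊗ₖ (coinProj (j, 0) * A)
      + translation (torusBasis j) ⊗ₖ (coinProj (j, 1) * A))

/-- `det (I - u M_A)`. -/
def walkDet {d : ℕ} (N : ℕ) [NeZero N] (A : Matrix (CoinIdx d) (CoinIdx d) ℂ) (u : ℂ) : ℂ :=
  (1 - u • walkMatrix N A).det

/-- The walk-type zeta function `det (I - u M_A) ^ (-1 / N^d)`.  The power is the branch obtained
from the value `1` at `u = 0` by continuation along the segment from `0` to `u`: the logarithm of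
the determinant is the integral of its logarithmic derivative along that segment
(see `walkZeta_pow_mul_walkDet`). -/
def walkZeta {d : ℕ} (N : ℕ) [NeZero N] (A : Matrix (CoinIdx d) (CoinIdx d) ℂ) (u : ℂ) : ℂ :=
  Complex.exp (-(1 / (N : ℂ) ^ d) *
    ∫ t in (0 : ℝ)..1, logDeriv (fun s : ℝ => walkDet N A ((s : ℂ) * u)) t)

theorem contDiff_walkDet {d : ℕ} (N : ℕ) [NeZero N] (A : Matrix (CoinIdx d) (CoinIdx d) ℂ)
    (u : ℂ) : ContDiff ℝ 1 (fun s : ℝ => walkDet N A ((s : ℂ) * u)) := by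
  unfold walkDet
  simp only [Matrix.det_apply]
  refine ContDiff.sum fun σ _ => ContDiff.const_smul _ (contDiff_prod fun i _ => ?_)
  simp only [Matrix.sub_apply, Matrix.smul_apply, smul_eq_mul]
  exact contDiff_const.sub
    (((Complex.ofRealCLM.contDiff).mul contDiff_const).mul contDiff_const)

/-- `walkZeta` is a value of `det (I - u M_A) ^ (-1 / N^d)`. -/
theorem walkZeta_pow_mul_walkDet {d : ℕ} (N : ℕ) [NeZero N]
    (A : Matrix (CoinIdx d) (CoinIdx d) ℂ) (u : ℂ)
    (h : ∀ t ∈ Set.Icc (0 : ℝ) 1, walkDet N A ((t : ℂ) * u) ≠ 0) :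
    walkZeta N A u ^ (N ^ d) * walkDet N A u = 1 := by
  set G : ℝ → ℂ := fun s => walkDet N A ((s : ℂ) * u) with hG
  have hC : ContDiff ℝ 1 G := contDiff_walkDet N A u
  have hd : Differentiable ℝ G := hC.differentiable (by norm_num)
  have hdc : Continuous (deriv G) := hC.continuous_deriv le_rfl
  have hmeas : MeasureTheory.StronglyMeasurable (logDeriv G) := by
    have hm : Measurable (fun t => deriv G t / G t) := hdc.measurable.div hd.continuous.measurable
    exact hm.stronglyMeasurable
  have hcont : ∀ t ∈ Set.Icc (0 : ℝ) 1, ContinuousAt (logDeriv G) t := fun t ht =>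
    hdc.continuousAt.div hd.continuous.continuousAt (h t ht)
  have hder : ∀ t ∈ Set.Icc (0 : ℝ) 1, HasDerivAt
      (fun x => Complex.exp (-∫ y in (0 : ℝ)..x, logDeriv G y) * G x) 0 t := by
    intro t ht
    have hint : IntervalIntegrable (logDeriv G) MeasureTheory.volume 0 t := by
      apply ContinuousOn.intervalIntegrable
      rw [Set.uIcc_of_le ht.1]
      exact fun x hx => (hcont x ⟨hx.1, hx.2.trans ht.2⟩).continuousWithinAt
    have h1 := intervalIntegral.integral_hasDerivAt_right hint
      (hmeas.stronglyMeasurableAtFilter) (hcont t ht)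
    have h2 := h1.neg.cexp.mul (hd t).hasDerivAt
    have hGt : G t ≠ 0 := h t ht
    refine h2.congr_deriv ?_
    have hl : logDeriv G t * G t = deriv G t := by
      rw [logDeriv_apply]
      exact div_mul_cancel₀ _ hGt
    rw [mul_assoc, neg_mul, hl]
    ring
  have hconst := constant_of_has_deriv_right_zero
    (fun t ht => (hder t ht).continuousAt.continuousWithinAt)
    (fun t ht => (hder t (Set.Ico_subset_Icc_self ht)).hasDerivWithinAt)
    1 (Set.right_mem_Icc.2 zero_le_one)
  have h0 : G 0 = 1 := by simp [hG, walkDet]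
  have h1 : G 1 = walkDet N A u := by simp [hG]
  simp only [intervalIntegral.integral_same, neg_zero, Complex.exp_zero, h0, h1, mul_one]
    at hconst
  have hN : (N : ℂ) ^ d ≠ 0 := pow_ne_zero _ (Nat.cast_ne_zero.2 (NeZero.ne N))
  rw [walkZeta, ← Complex.exp_nat_mul]
  convert hconst using 3
  push_cast
  rw [neg_mul, mul_neg, ← mul_assoc, mul_one_div_cancel hN, one_mul]

theorem walkZeta_zero {d : ℕ} (N : ℕ) [NeZero N] (A : Matrix (CoinIdx d) (CoinIdx d) ℂ) :
    walkZeta N A 0 = 1 := by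
  simp [walkZeta, logDeriv]

/-- `F^{(f)}(w, u, a) = 1 - (2 (d + (1-d) a) / d) (∑_j cos w_j) u + (2d - 1 + 2 (1-d) a) u²`. -/
def groverF {d : ℕ} (w : Fin d → ℝ) (u : ℂ) (a : ℝ) : ℂ :=
  1 - ((2 * ((d : ℝ) + (1 - (d : ℝ)) * a) / (d : ℝ) * ∑ j, Real.cos (w j) : ℝ) : ℂ) * u
    + ((2 * (d : ℝ) - 1 + 2 * (1 - (d : ℝ)) * a : ℝ) : ℂ) * u ^ 2

/-- The point `k̃ = (2π k_1 / N, …, 2π k_d / N)`. -/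
def waveVector {d N : ℕ} (k : Fin d → Fin N) : Fin d → ℝ :=
  fun j => 2 * Real.pi * ((k j : ℕ) : ℝ) / (N : ℝ)

/-- The uniform measure `(dθ_1 / 2π) ⋯ (dθ_d / 2π)` on `[0, 2π)^d`. -/
def uniformAngle (d : ℕ) : MeasureTheory.Measure (Fin d → ℝ) :=
  MeasureTheory.Measure.pi fun _ =>
    (ENNReal.ofReal (2 * Real.pi))⁻¹ •
      MeasureTheory.volume.restrict (Set.Ico (0 : ℝ) (2 * Real.pi))

/-- With `κ = 2d - 1 + 2 (1-d) a ≥ 1`, the open disc `κ |u|² < 1` without the real points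
`κ |u| ≥ 1`.  It is star-shaped about `0`, contains the disc `|u| < 1 / κ`, and is the set of all
`u` such that `(1 - z²)^(d-1) F(θ, z, a)` vanishes for no `z` in the segment from `0` to `u` and
no real vector `θ`. -/
def zetaDomain (d : ℕ) (a : ℝ) : Set ℂ :=
  {u | (2 * (d : ℝ) - 1 + 2 * (1 - (d : ℝ)) * a) * ‖u‖ ^ 2 < 1 ∧
    (u.im = 0 → (2 * (d : ℝ) - 1 + 2 * (1 - (d : ℝ)) * a) * |u.re| < 1)}

end

/-! The first half is an Ihara–Bass reduction. With `R` the involution reversing arcs and `L` the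
arc–tail incidence matrix, the flip-flop walk is `c R L Lᵀ - R`, a low-rank perturbation of `-R`.
Factoring `1 + u R` out of `1 - u M` and applying `det (1 + X Y) = det (1 + Y X)` leaves a
determinant on the vertices, a polynomial in the adjacency matrix (`walkDet_eq_det_torusAdj`). The
characters of the torus diagonalise it, so that `det (1 - u M)` is a power of `1 - u²` times the
product of the `F` over the wave vectors (`walkDet_eq_prod_groverF`).

The second half concerns the branch. On the star-shaped domain both `1 - u²` and every `F` stay in
the slit plane (`groverF_mem_slitPlane`), so principal logarithms are primitives of the logarithmic
derivative along the segment, and the zeta function is the exponential of an average of `log F`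
(`walkZeta_grover_inv`). That average is a Riemann sum of a continuous function, whence the limit
(`tendsto_riemann_sum_uniformAngle`). -/

/-! ### The walk in terms of arc reversal and incidence. -/

/-- The shift of arcs: the arc `(x, j, 0)` goes to `(x + e_j, j, 1)` and back. -/
def arcFlip {d N : ℕ} (p : Torus d N × CoinIdx d) : Torus d N × CoinIdx d :=
  if p.2.2 = 0 then (p.1 + torusBasis p.2.1, (p.2.1, 1)) else (p.1 - torusBasis p.2.1, (p.2.1, 0))

theorem arcFlip_zero {d N : ℕ} (x : Torus d N) (j : Fin d) :
    arcFlip (x, (j, 0)) = (x + torusBasis j, (j, 1)) := rfl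

theorem arcFlip_one {d N : ℕ} (x : Torus d N) (j : Fin d) :
    arcFlip (x, (j, 1)) = (x - torusBasis j, (j, 0)) := rfl

theorem arcFlip_arcFlip {d N : ℕ} (p : Torus d N × CoinIdx d) : arcFlip (arcFlip p) = p := by
  obtain ⟨x, j, s⟩ := p
  fin_cases s <;> simp [arcFlip]

/-- The permutation matrix of `arcFlip`. -/
def arcFlipMatrix (d N : ℕ) : Matrix (Torus d N × CoinIdx d) (Torus d N × CoinIdx d) ℂ :=
  (1 : Matrix (Torus d N × CoinIdx d) (Torus d N × CoinIdx d) ℂ).submatrix arcFlip id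

theorem arcFlipMatrix_mul {d N : ℕ} [NeZero N] {m : Type*}
    (X : Matrix (Torus d N × CoinIdx d) m ℂ) :
    arcFlipMatrix d N * X = X.submatrix arcFlip id := by
  ext p q
  simp [arcFlipMatrix, Matrix.mul_apply, Matrix.one_apply]

theorem arcFlipMatrix_mul_self (d N : ℕ) [NeZero N] :
    arcFlipMatrix d N * arcFlipMatrix d N = 1 := by
  rw [arcFlipMatrix_mul]
  ext p q
  rw [Matrix.submatrix_apply, arcFlipMatrix, Matrix.submatrix_apply, arcFlip_arcFlip]
  rfl

/-- The incidence matrix of arcs and their tails. -/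
def tailMatrix (d N : ℕ) : Matrix (Torus d N × CoinIdx d) (Torus d N) ℂ :=
  Matrix.of fun p y => if p.1 = y then 1 else 0

/-- The adjacency matrix of the torus, with multiplicities. -/
def torusAdj (d N : ℕ) : Matrix (Torus d N) (Torus d N) ℂ :=
  ∑ j : Fin d, (translation (-torusBasis j) + translation (torusBasis j))

theorem tailMatrix_transpose_mul {d N : ℕ} [NeZero N] {m : Type*}
    (X : Matrix (Torus d N × CoinIdx d) m ℂ) (x : Torus d N) (q : m) :
    ((tailMatrix d N)ᵀ * X) x q = ∑ c, X (x, c) q := by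
  simp only [tailMatrix, Matrix.mul_apply, Fintype.sum_prod_type, Matrix.transpose_apply,
    Matrix.of_apply, ite_mul, one_mul, zero_mul]
  rw [Finset.sum_eq_single x]
  · simp
  · intro b _ hb
    simp [hb]
  · simp

theorem tailMatrix_transpose_mul_self (d N : ℕ) [NeZero N] :
    (tailMatrix d N)ᵀ * tailMatrix d N = (2 * d : ℂ) • (1 : Matrix (Torus d N) (Torus d N) ℂ) := by
  ext x y
  rw [tailMatrix_transpose_mul]
  by_cases h : x = y <;> simp [tailMatrix, h, mul_comm]

/-- The tail of a reversed arc is its head, so each of the `2d` arcs leaving a vertex contributes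
one step to a neighbour. Loops and double edges for `N ≤ 2` are counted with multiplicity. -/
theorem tailMatrix_transpose_mul_arcFlipMatrix_mul (d N : ℕ) [NeZero N] :
    (tailMatrix d N)ᵀ * (arcFlipMatrix d N * tailMatrix d N) = torusAdj d N := by
  ext x y
  rw [tailMatrix_transpose_mul, arcFlipMatrix_mul]
  simp only [Matrix.submatrix_apply, tailMatrix, Matrix.of_apply, Fintype.sum_prod_type,
    Fin.sum_univ_two, torusAdj, Matrix.sum_apply, Matrix.add_apply, translation,
    arcFlip_zero, arcFlip_one, eq_comm, sub_neg_eq_add, id]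
  rfl

/-- The off-diagonal entry of the generalized Grover matrix of size `2d`. -/
noncomputable def groverCoeff (d : ℕ) (a : ℝ) : ℂ := (2 / ((d : ℂ) * 2) - 1) * (a : ℂ) + 1

/-- The Grover coin is `c J - 1` with `J` the all-ones matrix, and `L Lᵀ` is `J` at each vertex. The
flip `σ` exchanges the two orientations and the shift moves the vertex; together they are exactly
`R`. -/
theorem walkMatrix_flipFlop_grover (d N : ℕ) [NeZero N] (a : ℝ) :
    walkMatrix N (flipFlop (generalizedGrover (CoinIdx d) a)) =
      groverCoeff d a • (arcFlipMatrix d N * tailMatrix d N * (tailMatrix d N)ᵀ)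
        - arcFlipMatrix d N := by
  have key : ∀ (j : Fin d) (s : Fin 2) (q : CoinIdx d),
      flipFlop (generalizedGrover (CoinIdx d) a) (j, s) q
        = generalizedGrover (CoinIdx d) a (j, 1 - s) q := by
    intro j s q
    simp only [flipFlop, Matrix.mul_apply, Fintype.sum_prod_type, Matrix.kroneckerMap_apply]
    rw [Finset.sum_eq_single j]
    · fin_cases s <;> simp [flipMatrix]
    · intro b _ hb
      simp [hb.symm]
    · simp
  ext ⟨x, j, s⟩ ⟨y, q⟩
  rw [arcFlipMatrix_mul]
  have hP : ∀ (i : Fin d) (t : Fin 2),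
      (coinProj (i, t) * flipFlop (generalizedGrover (CoinIdx d) a)) (j, s) q
        = if (i, t) = (j, s) then generalizedGrover (CoinIdx d) a (j, 1 - s) q else 0 := by
    intro i t
    by_cases h : (i, t) = (j, s)
    · rw [if_pos h, ← key, h, coinProj, Matrix.single_mul_apply_same, one_mul]
    · rw [if_neg h, coinProj, Matrix.single_mul_apply_of_ne]
      exact fun h' => h h'.symm
  simp only [walkMatrix, Matrix.sum_apply, Matrix.add_apply, Matrix.kroneckerMap_apply, hP]
  rw [Finset.sum_eq_single j]
  · fin_cases s
    · simp [translation, generalizedGrover, tailMatrix, arcFlipMatrix, Matrix.mul_apply,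
        arcFlip_zero, Matrix.one_apply, groverCoeff, Prod.ext_iff (y := (y, q))]
      by_cases h : y = x + torusBasis j <;> simp [h, eq_comm]
    · simp [translation, generalizedGrover, tailMatrix, arcFlipMatrix, Matrix.mul_apply,
        arcFlip_one, Matrix.one_apply, groverCoeff, Prod.ext_iff (y := (y, q))]
      by_cases h : y = x - torusBasis j <;> simp [h, eq_comm]
  · intro b _ hb
    simp [hb]
  · simp

/-! ### The Ihara–Bass reduction to a vertex determinant. -/

/-- The arcs, split according to their orientation. -/
def arcSplit (d N : ℕ) :
    (Torus d N × Fin d) ⊕ (Torus d N × Fin d) ≃ Torus d N × CoinIdx d where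
  toFun := Sum.elim (fun p => (p.1, (p.2, 0))) (fun p => (p.1, (p.2, 1)))
  invFun p := if p.2.2 = 0 then Sum.inl (p.1, p.2.1) else Sum.inr (p.1, p.2.1)
  left_inv p := by rcases p with p | p <;> simp
  right_inv p := by
    obtain ⟨x, j, s⟩ := p
    fin_cases s <;> simp

/-- Reversal exchanges the two orientation classes, so in this splitting `R` is block antidiagonal
with mutually inverse blocks, and a Schur complement gives `det ((1 - u²) • 1)`. -/
theorem det_one_add_smul_arcFlipMatrix (d N : ℕ) [NeZero N] (u : ℂ) :
    (1 + u • arcFlipMatrix d N).det = (1 - u ^ 2) ^ (d * N ^ d) := by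
  rw [← Matrix.det_submatrix_equiv_self (arcSplit d N)]
  set V : Matrix (Torus d N × Fin d) (Torus d N × Fin d) ℂ :=
    Matrix.of fun p q => if q = (p.1 + torusBasis p.2, p.2) then 1 else 0 with hV
  set W : Matrix (Torus d N × Fin d) (Torus d N × Fin d) ℂ :=
    Matrix.of fun p q => if q = (p.1 - torusBasis p.2, p.2) then 1 else 0 with hW
  have hb : (1 + u • arcFlipMatrix d N).submatrix (arcSplit d N) (arcSplit d N)
      = Matrix.fromBlocks 1 (u • V) (u • W) 1 := by
    ext p q
    rcases p with ⟨x, j⟩ | ⟨x, j⟩ <;> rcases q with ⟨y, i⟩ | ⟨y, i⟩ <;>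
    simp [arcSplit, arcFlipMatrix, Matrix.one_apply, arcFlip_zero, arcFlip_one, hV, hW,
      eq_comm]
  have hWV : W * V = 1 := by
    ext p q
    rw [Matrix.mul_apply, Finset.sum_eq_single (p.1 - torusBasis p.2, p.2)]
    · simp [hV, hW, Matrix.one_apply, eq_comm]
    · intro b _ hb
      simp [hW, hb]
    · simp
  rw [hb, Matrix.det_fromBlocks_one₁₁, Matrix.smul_mul, Matrix.mul_smul, hWV, smul_smul,
    show (1 : Matrix (Torus d N × Fin d) (Torus d N × Fin d) ℂ) - (u * u) • 1
      = (1 - u ^ 2) • 1 by rw [sub_smul, one_smul, sq], Matrix.det_smul]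
  simp [ZMod.card, mul_comm]

theorem walkDet_eq_det_torusAdj_of_ne (d N : ℕ) [NeZero N] (hd : 1 ≤ d) (a : ℝ) {u : ℂ}
    (hu : 1 - u ^ 2 ≠ 0) :
    walkDet N (flipFlop (generalizedGrover (CoinIdx d) a)) u =
      (1 - u ^ 2) ^ ((d - 1) * N ^ d) *
        ((1 + (2 * d * groverCoeff d a - 1) * u ^ 2) • (1 : Matrix (Torus d N) (Torus d N) ℂ)
          - (u * groverCoeff d a) • torusAdj d N).det := by
  set R := arcFlipMatrix d N
  set L := tailMatrix d N
  set c := groverCoeff d a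
  have hRR : R * R = 1 := arcFlipMatrix_mul_self d N
  have hfac : 1 - u • walkMatrix N (flipFlop (generalizedGrover (CoinIdx d) a))
      = (1 + u • R) * (1 + (-(u * c / (1 - u ^ 2)) • ((R - u • 1) * L)) * Lᵀ) := by
    -- As `R² = 1`, this exhibits `(R - u) / (1 - u²)` as `(1 + u R)⁻¹ R`, which is what factoring
    -- out `1 + u R` requires.
    have h1 : (1 + u • R) * (R - u • 1) = (1 - u ^ 2) • R := by
      simp only [add_mul, mul_sub, one_mul, Matrix.smul_mul, Matrix.mul_smul, mul_one, hRR,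
        sub_smul, one_smul, smul_smul, sq]
      abel
    rw [walkMatrix_flipFlop_grover, mul_add, mul_one, Matrix.smul_mul, Matrix.mul_smul,
      ← Matrix.mul_assoc, ← Matrix.mul_assoc, h1, Matrix.smul_mul, Matrix.smul_mul, smul_smul]
    rw [neg_mul, div_mul_cancel₀ _ hu, smul_sub, smul_smul, neg_smul]
    abel
  have h2 : 1 + Lᵀ * (-(u * c / (1 - u ^ 2)) • ((R - u • 1) * L))
      = (1 - u ^ 2)⁻¹ • ((1 + (2 * d * c - 1) * u ^ 2) • (1 : Matrix (Torus d N) (Torus d N) ℂ)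
          - (u * c) • torusAdj d N) := by
    rw [Matrix.mul_smul, Matrix.sub_mul, Matrix.mul_sub, tailMatrix_transpose_mul_arcFlipMatrix_mul,
      Matrix.smul_mul, Matrix.one_mul, Matrix.mul_smul, tailMatrix_transpose_mul_self]
    ext x y
    simp only [Matrix.add_apply, Matrix.smul_apply, Matrix.sub_apply, smul_eq_mul]
    field_simp
    ring
  rw [walkDet, hfac, Matrix.det_mul, Matrix.det_one_add_mul_comm, h2, Matrix.det_smul,
    det_one_add_smul_arcFlipMatrix, ← mul_assoc]
  congr 1
  -- Of the `d N^d` factors `1 - u²`, the scalar `(1 - u²)⁻¹` in front of the vertex matrix cancels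
  -- `N^d`.
  obtain ⟨e, rfl⟩ := Nat.exists_eq_add_of_le' hd
  simp only [Fintype.card_pi, ZMod.card, Finset.prod_const, Finset.card_univ, Fintype.card_fin,
    Nat.add_sub_cancel]
  rw [add_mul, one_mul, pow_add, mul_assoc, inv_pow, mul_inv_cancel₀ (pow_ne_zero _ hu), mul_one]

/-- Both sides are continuous in `u`, and the excluded points `±1` have dense complement. -/
theorem walkDet_eq_det_torusAdj (d N : ℕ) [NeZero N] (hd : 1 ≤ d) (a : ℝ) (u : ℂ) :
    walkDet N (flipFlop (generalizedGrover (CoinIdx d) a)) u =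
      (1 - u ^ 2) ^ ((d - 1) * N ^ d) *
        ((1 + (2 * d * groverCoeff d a - 1) * u ^ 2) • (1 : Matrix (Torus d N) (Torus d N) ℂ)
          - (u * groverCoeff d a) • torusAdj d N).det := by
  have hdense : Dense ({1, -1} : Set ℂ)ᶜ := (Set.toFinite _).countable.dense_compl ℂ
  refine congrFun (Continuous.ext_on (f := fun u => walkDet N _ u) (g := fun u =>
    (1 - u ^ 2) ^ ((d - 1) * N ^ d) *
        ((1 + (2 * d * groverCoeff d a - 1) * u ^ 2) • (1 : Matrix (Torus d N) (Torus d N) ℂ)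
          - (u * groverCoeff d a) • torusAdj d N).det) hdense ?_ ?_ ?_) u
  · unfold walkDet
    exact Continuous.matrix_det (by fun_prop)
  · exact Continuous.mul (by fun_prop) (Continuous.matrix_det (by fun_prop))
  · intro v hv
    refine walkDet_eq_det_torusAdj_of_ne d N hd a fun h => hv ?_
    have : (v - 1) * (v + 1) = 0 := by linear_combination -h
    rcases mul_eq_zero.1 this with h | h
    · exact Or.inl (sub_eq_zero.1 h)
    · exact Or.inr (eq_neg_of_add_eq_zero_left h)

/-! ### Fourier diagonalisation of the adjacency matrix. -/

/-- The matrix of the characters of the torus. -/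
noncomputable def torusFourier (d N : ℕ) [NeZero N] : Matrix (Torus d N) (Torus d N) ℂ :=
  Matrix.of fun x k => ∏ j, ZMod.stdAddChar (x j * k j)

/-- Orthogonality of characters: the conjugate transpose is an inverse up to the factor `N^d`. The
sum over the torus splits into one-dimensional character sums. -/
theorem det_torusFourier_ne_zero (d N : ℕ) [NeZero N] : (torusFourier d N).det ≠ 0 := by
  have h : (Matrix.of fun k x : Torus d N => ∏ j, ZMod.stdAddChar (-(x j * k j)))
      * torusFourier d N = ((N : ℂ) ^ d) • 1 := by
    ext k l
    simp only [torusFourier, Matrix.mul_apply, Matrix.of_apply, ← Finset.prod_mul_distrib,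
      ← AddChar.map_add_eq_mul]
    have hs := Finset.prod_univ_sum (fun _ : Fin d => (Finset.univ : Finset (ZMod N)))
      (fun j y => (ZMod.stdAddChar (-(y * k j) + y * l j) : ℂ))
    rw [Fintype.piFinset_univ] at hs
    rw [← hs]
    have ho : ∀ j, ∑ y : ZMod N, (ZMod.stdAddChar (-(y * k j) + y * l j) : ℂ)
        = if k j = l j then (N : ℂ) else 0 := by
      intro j
      have := AddChar.sum_mulShift (l j - k j) (ZMod.isPrimitive_stdAddChar N)
      rw [ZMod.card] at this
      simp only [sub_eq_zero, eq_comm (a := l j)] at this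
      push_cast at this
      rw [← this]
      refine Finset.sum_congr rfl fun y _ => congrArg _ ?_
      ring
    simp only [ho]
    by_cases hkl : k = l
    · simp [hkl]
    · obtain ⟨j, hj⟩ := Function.ne_iff.1 hkl
      rw [Finset.prod_eq_zero (Finset.mem_univ j) (if_neg hj)]
      simp [hkl]
  intro h0
  have h1 := congrArg Matrix.det h
  rw [Matrix.det_mul, h0, mul_zero, Matrix.det_smul, Matrix.det_one, mul_one] at h1
  exact pow_ne_zero _ (pow_ne_zero _ (Nat.cast_ne_zero.2 (NeZero.ne N))) h1.symm

theorem translation_mul_torusFourier (d N : ℕ) [NeZero N] (v : Torus d N) :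
    translation v * torusFourier d N
      = torusFourier d N * Matrix.diagonal fun k => ∏ j, ZMod.stdAddChar (-(v j * k j)) := by
  ext x k
  rw [Matrix.mul_diagonal]
  simp [translation, torusFourier, Matrix.mul_apply, ← Finset.prod_mul_distrib,
    ← AddChar.map_add_eq_mul, sub_mul, ← sub_eq_add_neg]

theorem stdAddChar_neg_add_self {N : ℕ} [NeZero N] (k : ZMod N) :
    (ZMod.stdAddChar (-k) + ZMod.stdAddChar k : ℂ)
      = ((2 * Real.cos (2 * Real.pi * (k.val : ℝ) / N) : ℝ) : ℂ) := by
  have h : (ZMod.stdAddChar k : ℂ) = Complex.exp (2 * Real.pi * Complex.I * k.val / N) := by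
    rw [ZMod.stdAddChar_apply, ZMod.toCircle_apply]
  rw [AddChar.map_neg_eq_inv, h, ← Complex.exp_neg]
  push_cast
  rw [Complex.two_cos, add_comm]
  congr 2 <;> ring

theorem torusAdj_mul_torusFourier (d N : ℕ) [NeZero N] :
    torusAdj d N * torusFourier d N = torusFourier d N * Matrix.diagonal fun k =>
      ((2 * ∑ j, Real.cos (2 * Real.pi * ((k j).val : ℝ) / N) : ℝ) : ℂ) := by
  -- Only the `j`-th coordinate of the basis vector contributes. The map `f` is the identity or
  -- negation, which treats both shift directions at once.
  have h : ∀ (j : Fin d) (k : Torus d N) (f : ZMod N → ZMod N) (_ : ∀ z, f z = z ∨ f z = -z),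
      ∏ i, (ZMod.stdAddChar (f ((torusBasis j : Torus d N) i * k i)) : ℂ)
        = ZMod.stdAddChar (f (k j)) := by
    intro j k f hf
    rw [Finset.prod_eq_single j]
    · simp [torusBasis]
    · intro i _ hi
      have : f 0 = 0 := by rcases hf 0 with h | h <;> simp [h]
      simp [torusBasis, Pi.single_eq_of_ne hi, this]
    · simp
  rw [torusAdj, Finset.sum_mul]
  simp only [add_mul, translation_mul_torusFourier, ← mul_add, ← Finset.mul_sum]
  congr 1
  ext k l
  simp only [Matrix.sum_apply, Matrix.add_apply, Matrix.diagonal_apply]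
  by_cases hkl : k = l
  · simp only [hkl, if_true]
    push_cast [Finset.mul_sum]
    refine Finset.sum_congr rfl fun j _ => ?_
    have h1 := h j l (fun z => z) (fun z => Or.inl rfl)
    have h2 := h j l (fun z => -z) (fun z => Or.inr rfl)
    simp only [Pi.neg_apply, neg_mul, neg_neg]
    rw [h1, h2, add_comm, stdAddChar_neg_add_self]
    push_cast
    rfl
  · simp [hkl]

theorem det_smul_one_sub_smul_torusAdj (d N : ℕ) [NeZero N] (s t : ℂ) :
    (s • (1 : Matrix (Torus d N) (Torus d N) ℂ) - t • torusAdj d N).det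
      = ∏ k : Fin d → Fin N, (s - t * ((2 * ∑ j, Real.cos (waveVector k j) : ℝ) : ℂ)) := by
  have h : (s • (1 : Matrix (Torus d N) (Torus d N) ℂ) - t • torusAdj d N) * torusFourier d N
      = torusFourier d N * Matrix.diagonal fun k =>
        s - t * ((2 * ∑ j, Real.cos (2 * Real.pi * ((k j).val : ℝ) / N) : ℝ) : ℂ) := by
    rw [sub_mul, Matrix.smul_mul, Matrix.smul_mul, one_mul, torusAdj_mul_torusFourier]
    ext x k
    simp only [Matrix.sub_apply, Matrix.smul_apply, Matrix.mul_diagonal, smul_eq_mul]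
    ring
  have hdet := congrArg Matrix.det h
  rw [Matrix.det_mul, Matrix.det_mul, mul_comm, Matrix.det_diagonal] at hdet
  rw [mul_left_cancel₀ (det_torusFourier_ne_zero d N) hdet]
  -- For a successor, `ZMod` unfolds to `Fin`, so the two index sets agree definitionally.
  obtain ⟨n, rfl⟩ := Nat.exists_eq_succ_of_ne_zero (NeZero.ne N)
  rfl

theorem two_mul_groverCoeff (d : ℕ) (hd : 1 ≤ d) (a : ℝ) :
    2 * groverCoeff d a = ((2 * ((d : ℝ) + (1 - (d : ℝ)) * a) / (d : ℝ) : ℝ) : ℂ) := by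
  have : (d : ℂ) ≠ 0 := by exact_mod_cast (by omega : d ≠ 0)
  rw [groverCoeff]
  push_cast
  field_simp
  ring

theorem walkDet_eq_prod_groverF (d N : ℕ) [NeZero N] (hd : 1 ≤ d) (a : ℝ) (u : ℂ) :
    walkDet N (flipFlop (generalizedGrover (CoinIdx d) a)) u =
      (1 - u ^ 2) ^ ((d - 1) * N ^ d) * ∏ k : Fin d → Fin N, groverF (waveVector k) u a := by
  rw [walkDet_eq_det_torusAdj d N hd, det_smul_one_sub_smul_torusAdj]
  congr 1
  refine Finset.prod_congr rfl fun k _ => ?_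
  have h1 := two_mul_groverCoeff d hd a
  have h2 : 2 * d * groverCoeff d a - 1
      = ((2 * (d : ℝ) - 1 + 2 * (1 - (d : ℝ)) * a : ℝ) : ℂ) := by
    have : (d : ℂ) ≠ 0 := by exact_mod_cast (by omega : d ≠ 0)
    rw [mul_right_comm, h1]
    push_cast
    field_simp
    ring
  rw [groverF, h2, Complex.ofReal_mul 2, Complex.ofReal_mul _ (∑ j, _), ← h1, Complex.ofReal_ofNat]
  ring

/-! ### Non-vanishing on the domain. -/

theorem one_le_groverKappa {d : ℕ} (hd : 1 ≤ d) {a : ℝ} (ha : a ∈ Set.Icc (0 : ℝ) 1) :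
    1 ≤ 2 * (d : ℝ) - 1 + 2 * (1 - (d : ℝ)) * a := by
  have hd' : (1 : ℝ) ≤ d := by exact_mod_cast hd
  nlinarith [ha.1, ha.2, mul_nonneg (sub_nonneg.2 hd') (sub_nonneg.2 ha.2)]

/-- The cosine sum is at most `d` in absolute value, and `2 (d + (1 - d) a) = κ + 1`. -/
theorem abs_groverCoeff_mul_sum_cos_le {d : ℕ} (hd : 1 ≤ d) {a : ℝ}
    (ha : a ∈ Set.Icc (0 : ℝ) 1) (θ : Fin d → ℝ) :
    |2 * ((d : ℝ) + (1 - (d : ℝ)) * a) / (d : ℝ) * ∑ j, Real.cos (θ j)|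
      ≤ (2 * (d : ℝ) - 1 + 2 * (1 - (d : ℝ)) * a) + 1 := by
  have hd0 : (0 : ℝ) < d := by exact_mod_cast hd
  have hκ := one_le_groverKappa hd ha
  have hs : |∑ j, Real.cos (θ j)| ≤ d := by
    refine (Finset.abs_sum_le_sum_abs _ _).trans ?_
    refine (Finset.sum_le_sum fun j _ => Real.abs_cos_le_one (θ j)).trans ?_
    simp
  have hc : 0 ≤ 2 * ((d : ℝ) + (1 - (d : ℝ)) * a) / (d : ℝ) :=
    div_nonneg (by linarith) hd0.le
  rw [abs_mul, abs_of_nonneg hc]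
  refine (mul_le_mul_of_nonneg_left hs hc).trans (le_of_eq ?_)
  field_simp
  ring

theorem norm_lt_one_of_mem_zetaDomain {d : ℕ} (hd : 1 ≤ d) {a : ℝ} (ha : a ∈ Set.Icc (0 : ℝ) 1)
    {u : ℂ} (hu : u ∈ zetaDomain d a) : ‖u‖ < 1 := by
  have hκ := one_le_groverKappa hd ha
  have h := hu.1
  nlinarith [norm_nonneg u, sq_nonneg ‖u‖]

theorem one_sub_sq_mem_slitPlane {u : ℂ} (hu : ‖u‖ < 1) : 1 - u ^ 2 ∈ Complex.slitPlane := by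
  rw [sub_eq_add_neg]
  refine Complex.mem_slitPlane_of_norm_lt_one ?_
  rw [norm_neg, norm_pow]
  exact pow_lt_one₀ (norm_nonneg u) hu two_ne_zero

/-- Write `F = 1 - b u + κ u²` with `b` real and `|b| ≤ κ + 1`. For real `u`, `F ≥ (1 - κ|u|)(1 -
|u|) > 0`. For non-real `u`, the imaginary part vanishes only if `b = 2κ Re u`, and then the real
part is `1 - κ|u|² > 0`. -/
theorem groverF_mem_slitPlane {d : ℕ} (hd : 1 ≤ d) {a : ℝ} (ha : a ∈ Set.Icc (0 : ℝ) 1)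
    {u : ℂ} (hu : u ∈ zetaDomain d a) (θ : Fin d → ℝ) :
    groverF θ u a ∈ Complex.slitPlane := by
  have hκ := one_le_groverKappa hd ha
  have hb := abs_groverCoeff_mul_sum_cos_le hd ha θ
  have hu1 := norm_lt_one_of_mem_zetaDomain hd ha hu
  obtain ⟨hn, hr⟩ := hu
  rw [groverF]
  generalize 2 * (d : ℝ) - 1 + 2 * (1 - (d : ℝ)) * a = κ at *
  generalize 2 * ((d : ℝ) + (1 - (d : ℝ)) * a) / (d : ℝ) * ∑ j, Real.cos (θ j) = b at *
  rw [← Complex.normSq_eq_norm_sq, Complex.normSq_apply] at hn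
  have hre : (1 - (b : ℂ) * u + (κ : ℂ) * u ^ 2).re
      = 1 - b * u.re + κ * (u.re * u.re - u.im * u.im) := by
    simp [sq]
  have him : (1 - (b : ℂ) * u + (κ : ℂ) * u ^ 2).im = u.im * (2 * κ * u.re - b) := by
    simp [sq]
    ring
  rw [Complex.mem_slitPlane_iff, hre, him]
  by_cases hi : u.im = 0
  · left
    have h1 := hr hi
    have h2 : |u.re| < 1 := (Complex.abs_re_le_norm u).trans_lt hu1
    have h3 : b * u.re ≤ (κ + 1) * |u.re| :=
      (le_abs_self _).trans (by rw [abs_mul]; exact mul_le_mul_of_nonneg_right hb (abs_nonneg _))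
    rw [hi]
    nlinarith [mul_pos (sub_pos.2 h1) (sub_pos.2 h2), abs_mul_abs_self u.re]
  · by_cases h : 2 * κ * u.re - b = 0
    · left
      have : b = 2 * κ * u.re := by linarith
      rw [this]
      nlinarith
    · exact Or.inr (mul_ne_zero hi h)

theorem smul_mem_zetaDomain {d : ℕ} (hd : 1 ≤ d) {a : ℝ} (ha : a ∈ Set.Icc (0 : ℝ) 1)
    {u : ℂ} (hu : u ∈ zetaDomain d a) {t : ℝ} (ht : t ∈ Set.Icc (0 : ℝ) 1) :
    (t : ℂ) * u ∈ zetaDomain d a := by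
  have hκ := one_le_groverKappa hd ha
  refine ⟨?_, fun h => ?_⟩
  · refine lt_of_le_of_lt (mul_le_mul_of_nonneg_left ?_ (by linarith)) hu.1
    rw [norm_mul, Complex.norm_real, Real.norm_of_nonneg ht.1]
    exact pow_le_pow_left₀ (by positivity [ht.1]) (mul_le_of_le_one_left (norm_nonneg u) ht.2) 2
  · rw [Complex.re_ofReal_mul, abs_mul, abs_of_nonneg ht.1]
    rw [Complex.im_ofReal_mul] at h
    rcases mul_eq_zero.1 h with h | h
    · simp [h]
    · refine lt_of_le_of_lt (mul_le_mul_of_nonneg_left ?_ (by linarith)) (hu.2 h)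
      exact mul_le_of_le_one_left (abs_nonneg _) ht.2

/-! ### Identification of the branch. -/

theorem differentiable_groverF_ofReal_mul {d : ℕ} (θ : Fin d → ℝ) (u : ℂ) (a : ℝ) :
    Differentiable ℝ fun s : ℝ => groverF θ ((s : ℂ) * u) a := by
  have h : Differentiable ℝ fun s : ℝ => (s : ℂ) := Complex.ofRealCLM.differentiable
  unfold groverF
  fun_prop

/-- If `walkDet` has a logarithm along the segment from `0` to `u`, then it computes the zeta
function. -/
theorem walkZeta_inv_eq_exp {d N : ℕ} [NeZero N] {A : Matrix (CoinIdx d) (CoinIdx d) ℂ} {u : ℂ}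
    (h : ∀ t ∈ Set.Icc (0 : ℝ) 1, walkDet N A ((t : ℂ) * u) ≠ 0) {g : ℝ → ℂ}
    (hg : ∀ t ∈ Set.Icc (0 : ℝ) 1,
      HasDerivAt g (logDeriv (fun s : ℝ => walkDet N A ((s : ℂ) * u)) t) t) :
    (walkZeta N A u)⁻¹ = Complex.exp (1 / (N : ℂ) ^ d * (g 1 - g 0)) := by
  have hC := contDiff_walkDet N A u
  have hint : IntervalIntegrable (logDeriv (fun s : ℝ => walkDet N A ((s : ℂ) * u)))
      MeasureTheory.volume 0 1 := by
    apply ContinuousOn.intervalIntegrable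
    rw [Set.uIcc_of_le zero_le_one]
    exact fun t ht => ((hC.continuous_deriv le_rfl).continuousAt.div
      hC.continuous.continuousAt (h t ht)).continuousWithinAt
  rw [walkZeta, intervalIntegral.integral_eq_sub_of_hasDerivAt
    (by rwa [Set.uIcc_of_le zero_le_one]) hint, ← Complex.exp_neg, neg_mul, neg_neg]

theorem walkDet_grover_ne_zero {d : ℕ} (hd : 1 ≤ d) {a : ℝ} (ha : a ∈ Set.Icc (0 : ℝ) 1)
    {u : ℂ} (hu : u ∈ zetaDomain d a) (N : ℕ) [NeZero N] :
    walkDet N (flipFlop (generalizedGrover (CoinIdx d) a)) u ≠ 0 := by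
  rw [walkDet_eq_prod_groverF d N hd]
  refine mul_ne_zero (pow_ne_zero _ (Complex.slitPlane_ne_zero ?_))
    (Finset.prod_ne_zero_iff.2 fun k _ => Complex.slitPlane_ne_zero ?_)
  · exact one_sub_sq_mem_slitPlane (norm_lt_one_of_mem_zetaDomain hd ha hu)
  · exact groverF_mem_slitPlane hd ha hu _

/-- Along the segment, `(d - 1) N^d log (1 - z²) + ∑ log F` is a primitive of the logarithmic
derivative, since no factor meets the cut. It vanishes at `z = 0`, and dividing by `N^d` leaves an
integral power of `1 - u²`. -/
theorem walkZeta_grover_inv {d : ℕ} (hd : 1 ≤ d) {a : ℝ} (ha : a ∈ Set.Icc (0 : ℝ) 1)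
    {u : ℂ} (hu : u ∈ zetaDomain d a) (N : ℕ) [NeZero N] :
    (walkZeta N (flipFlop (generalizedGrover (CoinIdx d) a)) u)⁻¹
      = (1 - u ^ 2) ^ (d - 1) * Complex.exp (1 / (N : ℂ) ^ d *
          ∑ k : Fin d → Fin N, Complex.log (groverF (waveVector k) u a)) := by
  have hN : (N : ℂ) ^ d ≠ 0 := pow_ne_zero _ (Nat.cast_ne_zero.2 (NeZero.ne N))
  have hmem : ∀ t ∈ Set.Icc (0 : ℝ) 1, 1 - ((t : ℂ) * u) ^ 2 ∈ Complex.slitPlane := fun t ht =>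
    one_sub_sq_mem_slitPlane (norm_lt_one_of_mem_zetaDomain hd ha (smul_mem_zetaDomain hd ha hu ht))
  have hdq : Differentiable ℝ fun s : ℝ => 1 - ((s : ℂ) * u) ^ 2 := by
    have h : Differentiable ℝ fun s : ℝ => (s : ℂ) := Complex.ofRealCLM.differentiable
    fun_prop
  have hdF := fun k : Fin d → Fin N => differentiable_groverF_ofReal_mul (waveVector k) u a
  rw [walkZeta_inv_eq_exp (g := fun s : ℝ =>
    (((d - 1) * N ^ d : ℕ) : ℂ) * Complex.log (1 - ((s : ℂ) * u) ^ 2) +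
      ∑ k : Fin d → Fin N, Complex.log (groverF (waveVector k) ((s : ℂ) * u) a))
    (fun t ht => walkDet_grover_ne_zero hd ha (smul_mem_zetaDomain hd ha hu ht) N)]
  · have h1 : 1 - u ^ 2 ≠ 0 := by
      simpa using Complex.slitPlane_ne_zero (hmem 1 (Set.right_mem_Icc.2 zero_le_one))
    simp only [Complex.ofReal_one, Complex.ofReal_zero, one_mul, zero_mul, groverF]
    simp only [ne_eq, OfNat.ofNat_ne_zero, not_false_eq_true, zero_pow, mul_zero, sub_zero,
      add_zero, Complex.log_one, Finset.sum_const_zero]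
    rw [mul_add, Complex.exp_add]
    congr 1
    rw [Nat.cast_mul, Nat.cast_pow, mul_comm _ ((N : ℂ) ^ d), mul_assoc, ← mul_assoc (1 / _),
      one_div_mul_cancel hN, one_mul, Complex.exp_nat_mul, Complex.exp_log h1]
  · intro t ht
    have hFt := fun k : Fin d → Fin N =>
      groverF_mem_slitPlane hd ha (smul_mem_zetaDomain hd ha hu ht) (waveVector k)
    simp only [walkDet_eq_prod_groverF d N hd]
    rw [logDeriv_mul (f := fun s : ℝ => (1 - ((s : ℂ) * u) ^ 2) ^ ((d - 1) * N ^ d))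
      (g := fun s : ℝ => ∏ k : Fin d → Fin N, groverF (waveVector k) ((s : ℂ) * u) a) t (pow_ne_zero _ (Complex.slitPlane_ne_zero (hmem t ht)))
      (Finset.prod_ne_zero_iff.2 fun k _ => Complex.slitPlane_ne_zero (hFt k))
      (hdq.pow _ t) (DifferentiableAt.fun_finsetProd fun k _ => hdF k t),
      logDeriv_fun_pow (hdq t),
      logDeriv_prod (f := fun (k : Fin d → Fin N) (s : ℝ) =>
        groverF (waveVector k) ((s : ℂ) * u) a) (fun k _ => Complex.slitPlane_ne_zero (hFt k)) (fun k _ => hdF k t)]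
    exact (((hdq t).hasDerivAt.clog_real (hmem t ht)).const_mul _).add
      (HasDerivAt.fun_sum fun k _ => (hdF k t).hasDerivAt.clog_real (hFt k))

/-- After taking the `N^d`-th power only `exp (log z) = z` is needed, so the choice of branch is
immaterial and `u` need not lie in the domain. -/
theorem grover_root_pow_eq_walkDet {d : ℕ} (hd : 1 ≤ d) (a : ℝ) (N : ℕ) [NeZero N] (u : ℂ)
    (h : ∀ k : Fin d → Fin N, groverF (waveVector k) u a ≠ 0) :
    ((1 - u ^ 2) ^ (d - 1) * Complex.exp (1 / (N : ℂ) ^ d *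
        ∑ k : Fin d → Fin N, Complex.log (groverF (waveVector k) u a))) ^ (N ^ d)
      = walkDet N (flipFlop (generalizedGrover (CoinIdx d) a)) u := by
  have hN : (N : ℂ) ^ d ≠ 0 := pow_ne_zero _ (Nat.cast_ne_zero.2 (NeZero.ne N))
  rw [walkDet_eq_prod_groverF d N hd, mul_pow, ← pow_mul, ← Complex.exp_nat_mul, Nat.cast_pow,
    ← mul_assoc, mul_one_div_cancel hN, one_mul, Complex.exp_sum]
  congr 1
  exact Finset.prod_congr rfl fun k _ => Complex.exp_log (h k)

/-! ### Riemann sums over the wave vectors. -/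

/-- The index of the arc `[2πk/N, 2π(k+1)/N)` that contains `t`. -/
noncomputable def angleIndex (N : ℕ) [NeZero N] (t : ℝ) : Fin N :=
  Fin.ofNat N ⌊(N : ℝ) * (t / (2 * Real.pi))⌋₊

theorem measurable_angleIndex (N : ℕ) [NeZero N] : Measurable (angleIndex N) := by
  have h : Measurable fun t : ℝ => ⌊(N : ℝ) * (t / (2 * Real.pi))⌋₊ :=
    Nat.measurable_floor.comp (by fun_prop)
  exact (measurable_of_countable (Fin.ofNat N)).comp h

theorem val_angleIndex {N : ℕ} [NeZero N] {t : ℝ} (ht : t ∈ Set.Ico (0 : ℝ) (2 * Real.pi)) :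
    (angleIndex N t : ℕ) = ⌊(N : ℝ) * (t / (2 * Real.pi))⌋₊ := by
  have hN : (0 : ℝ) < N := Nat.cast_pos.2 (NeZero.pos N)
  rw [angleIndex, Fin.val_ofNat]
  refine Nat.mod_eq_of_lt ((Nat.floor_lt (by have := ht.1; positivity)).2 ?_)
  exact mul_lt_of_lt_one_right hN ((div_lt_one Real.two_pi_pos).2 ht.2)

/-- Restriction to `[0, 2π)` is essential: elsewhere the natural-number floor truncates negative
values to `0` and `Fin.ofNat` reduces modulo `N`. -/
theorem angleIndex_preimage_inter (N : ℕ) [NeZero N] (k : Fin N) :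
    angleIndex N ⁻¹' {k} ∩ Set.Ico (0 : ℝ) (2 * Real.pi)
      = Set.Ico (2 * Real.pi * ((k : ℕ) : ℝ) / N) (2 * Real.pi * (((k : ℕ) : ℝ) + 1) / N) := by
  have hN : (0 : ℝ) < N := Nat.cast_pos.2 (NeZero.pos N)
  have hpi := Real.two_pi_pos
  have hiff : ∀ t : ℝ, t ∈ Set.Ico (2 * Real.pi * ((k : ℕ) : ℝ) / N)
        (2 * Real.pi * (((k : ℕ) : ℝ) + 1) / N) ↔
      ((k : ℕ) : ℝ) ≤ N * (t / (2 * Real.pi)) ∧ N * (t / (2 * Real.pi)) < ((k : ℕ) : ℝ) + 1 := by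
    intro t
    rw [Set.mem_Ico, div_le_iff₀ hN, lt_div_iff₀ hN, ← mul_div_assoc, le_div_iff₀ hpi,
      div_lt_iff₀ hpi, mul_comm (N : ℝ), mul_comm (2 * Real.pi), mul_comm (2 * Real.pi)]
  ext t
  rw [hiff]
  constructor
  · rintro ⟨hk, ht⟩
    rw [← Nat.floor_eq_iff (by have := ht.1; positivity), ← val_angleIndex ht]
    exact congrArg Fin.val hk
  · intro h
    have h0 : 0 ≤ t / (2 * Real.pi) :=
      nonneg_of_mul_nonneg_right ((Nat.cast_nonneg _).trans h.1) hN
    have ht : t ∈ Set.Ico (0 : ℝ) (2 * Real.pi) := by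
      refine ⟨by simpa using (le_div_iff₀ hpi).1 h0, (div_lt_one hpi).1 ?_⟩
      have hk : ((k : ℕ) : ℝ) + 1 ≤ N := by exact_mod_cast k.2
      exact (mul_lt_iff_lt_one_right hN).1 (h.2.trans_le hk)
    refine ⟨Fin.ext ?_, ht⟩
    rw [val_angleIndex ht, Nat.floor_eq_iff (by positivity)]
    exact h

theorem tendsto_waveVector_angleIndex {d : ℕ} {θ : Fin d → ℝ}
    (hθ : ∀ j, θ j ∈ Set.Ico (0 : ℝ) (2 * Real.pi)) :
    Filter.Tendsto (fun N : ℕ+ => waveVector fun j => angleIndex (N : ℕ) (θ j))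
      Filter.atTop (nhds θ) := by
  rw [tendsto_pi_nhds]
  intro j
  have hpi := Real.two_pi_pos
  have h := (tendsto_nat_floor_mul_div_atTop (R := ℝ)
    (div_nonneg (hθ j).1 hpi.le)).const_mul (2 * Real.pi)
  rw [mul_div_cancel₀ _ hpi.ne'] at h
  have hN : Filter.Tendsto (fun N : ℕ+ => ((N : ℕ) : ℝ)) Filter.atTop Filter.atTop :=
    tendsto_natCast_atTop_atTop.comp tendsto_PNat_val_atTop_atTop
  refine (h.comp hN).congr fun N => ?_
  simp only [Function.comp_apply, waveVector, val_angleIndex (hθ j)]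
  rw [mul_div_assoc, mul_comm (θ j / _)]

/-- The uniform probability measure on `[0, 2π)`. -/
noncomputable def uniformAngleOne : MeasureTheory.Measure ℝ :=
  (ENNReal.ofReal (2 * Real.pi))⁻¹ •
    MeasureTheory.volume.restrict (Set.Ico (0 : ℝ) (2 * Real.pi))

instance : MeasureTheory.IsProbabilityMeasure uniformAngleOne := by
  constructor
  rw [uniformAngleOne, MeasureTheory.Measure.smul_apply, MeasureTheory.Measure.restrict_apply_univ,
    Real.volume_Ico, sub_zero, smul_eq_mul]
  exact ENNReal.inv_mul_cancel (ENNReal.ofReal_pos.2 Real.two_pi_pos).ne' ENNReal.ofReal_ne_top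

theorem uniformAngle_eq_pi (d : ℕ) :
    uniformAngle d = MeasureTheory.Measure.pi fun _ => uniformAngleOne := rfl

instance (d : ℕ) : MeasureTheory.IsProbabilityMeasure (uniformAngle d) := by
  rw [uniformAngle_eq_pi]
  infer_instance

theorem ae_uniformAngle_mem_Ico (d : ℕ) :
    ∀ᵐ θ ∂uniformAngle d, ∀ j, θ j ∈ Set.Ico (0 : ℝ) (2 * Real.pi) := by
  rw [Filter.eventually_all, uniformAngle_eq_pi]
  intro j
  have h : ∀ᵐ t ∂uniformAngleOne, t ∈ Set.Ico (0 : ℝ) (2 * Real.pi) :=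
    MeasureTheory.Measure.ae_smul_measure (MeasureTheory.ae_restrict_mem measurableSet_Ico) _
  exact (MeasureTheory.Measure.tendsto_eval_ae_ae
    (μ := fun _ : Fin d => uniformAngleOne)).eventually h

theorem map_angleIndex_real_singleton (N : ℕ) [NeZero N] (k : Fin N) :
    (uniformAngleOne.map (angleIndex N)).real {k} = 1 / N := by
  have hN : (0 : ℝ) < N := Nat.cast_pos.2 (NeZero.pos N)
  rw [MeasureTheory.map_measureReal_apply (measurable_angleIndex N) (measurableSet_singleton k),
    uniformAngleOne, MeasureTheory.measureReal_ennreal_smul_apply,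
    MeasureTheory.measureReal_restrict_apply
      (measurable_angleIndex N (measurableSet_singleton k)), angleIndex_preimage_inter,
    Real.volume_real_Ico_of_le (by gcongr; linarith), ENNReal.toReal_inv,
    ENNReal.toReal_ofReal Real.two_pi_pos.le]
  field_simp
  ring

/-- Rounding angles down to the grid pushes the uniform measure to the uniform measure on grid
indices, each of mass `N^(-d)`. The Riemann sum is thus exactly the integral of a step function,
over a measure independent of `N`. -/
theorem integral_waveVector_angleIndex {d : ℕ} (N : ℕ) [NeZero N] (h : (Fin d → ℝ) → ℂ) :
    ∫ θ, h (waveVector fun j => angleIndex N (θ j)) ∂uniformAngle d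
      = 1 / (N : ℂ) ^ d * ∑ k : Fin d → Fin N, h (waveVector k) := by
  have hm := measurable_angleIndex N
  have hm' : Measurable fun (θ : Fin d → ℝ) j => angleIndex N (θ j) :=
    measurable_pi_lambda _ fun j => hm.comp (measurable_pi_apply j)
  have : MeasureTheory.IsProbabilityMeasure (uniformAngleOne.map (angleIndex N)) :=
    MeasureTheory.Measure.isProbabilityMeasure_map hm.aemeasurable
  have hf : Measurable fun k : Fin d → Fin N => h (waveVector k) := measurable_of_countable _
  rw [← MeasureTheory.integral_map (φ := fun (θ : Fin d → ℝ) j => angleIndex N (θ j))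
    (f := fun k => h (waveVector k)) hm'.aemeasurable hf.aestronglyMeasurable,
    uniformAngle_eq_pi, MeasureTheory.Measure.pi_map_pi fun _ => hm.aemeasurable,
    MeasureTheory.integral_fintype MeasureTheory.Integrable.of_finite, Finset.mul_sum]
  refine Finset.sum_congr rfl fun k _ => ?_
  rw [MeasureTheory.measureReal_def, MeasureTheory.Measure.pi_singleton, ENNReal.toReal_prod]
  simp only [← MeasureTheory.measureReal_def, map_angleIndex_real_singleton]
  simp

theorem waveVector_mem_Icc {d N : ℕ} (k : Fin d → Fin N) :
    waveVector k ∈ Set.Icc (0 : Fin d → ℝ) (fun _ => 2 * Real.pi) := by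
  have hpi := Real.two_pi_pos
  refine ⟨fun j => by simp only [waveVector, Pi.zero_apply]; positivity, fun j => ?_⟩
  have hN : (0 : ℝ) < N := Nat.cast_pos.2 ((Nat.zero_le _).trans_lt (k j).2)
  rw [waveVector, div_le_iff₀ hN]
  exact mul_le_mul_of_nonneg_left (Nat.cast_le.2 (k j).2.le) hpi.le

theorem integrable_uniformAngle {d : ℕ} {h : (Fin d → ℝ) → ℂ} (hh : Continuous h) :
    MeasureTheory.Integrable h (uniformAngle d) := by
  obtain ⟨C, hC⟩ := (isCompact_Icc (a := (0 : Fin d → ℝ))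
    (b := fun _ => 2 * Real.pi)).exists_bound_of_continuousOn hh.continuousOn
  refine MeasureTheory.Integrable.of_bound hh.aestronglyMeasurable C ?_
  filter_upwards [ae_uniformAngle_mem_Ico d] with θ hθ
  exact hC θ ⟨fun j => (hθ j).1, fun j => (hθ j).2.le⟩

/-- Dominated convergence: the rounded angles converge to `θ` almost everywhere, and all of them lie
in the compact cube `[0, 2π]^d`, where `h` is bounded. -/
theorem tendsto_riemann_sum_uniformAngle {d : ℕ} {h : (Fin d → ℝ) → ℂ} (hh : Continuous h) :
    Filter.Tendsto
      (fun N : ℕ+ => 1 / ((N : ℕ) : ℂ) ^ d * ∑ k : Fin d → Fin (N : ℕ), h (waveVector k))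
      Filter.atTop (nhds (∫ θ, h θ ∂uniformAngle d)) := by
  obtain ⟨C, hC⟩ := (isCompact_Icc (a := (0 : Fin d → ℝ))
    (b := fun _ => 2 * Real.pi)).exists_bound_of_continuousOn hh.continuousOn
  simp only [← integral_waveVector_angleIndex]
  refine MeasureTheory.tendsto_integral_filter_of_dominated_convergence (fun _ => C)
    (Filter.Eventually.of_forall fun N => ?_)
    (Filter.Eventually.of_forall fun N => Filter.Eventually.of_forall fun θ =>
      hC _ (waveVector_mem_Icc _)) (MeasureTheory.integrable_const C) ?_
  · have hm' : Measurable fun (θ : Fin d → ℝ) j => angleIndex (N : ℕ) (θ j) :=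
      measurable_pi_lambda _ fun j => (measurable_angleIndex _).comp (measurable_pi_apply j)
    exact ((measurable_of_countable fun k : Fin d → Fin (N : ℕ) =>
      h (waveVector k)).comp hm').aestronglyMeasurable
  · filter_upwards [ae_uniformAngle_mem_Ico d] with θ hθ
    exact (hh.tendsto θ).comp (tendsto_waveVector_angleIndex hθ)

theorem continuous_log_groverF {d : ℕ} (hd : 1 ≤ d) {a : ℝ} (ha : a ∈ Set.Icc (0 : ℝ) 1)
    {u : ℂ} (hu : u ∈ zetaDomain d a) :
    Continuous fun θ : Fin d → ℝ => Complex.log (groverF θ u a) := by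
  refine Continuous.clog ?_ (groverF_mem_slitPlane hd ha hu)
  unfold groverF
  fun_prop

theorem mainTheorem2 (d : ℕ) (hd : 1 ≤ d) (a : ℝ) (ha : a ∈ Set.Icc (0 : ℝ) 1) :
    -- for all `u`: the right-hand side is an `N^d`-th root of `det (I - u M)`
    (∀ (N : ℕ) [NeZero N] (u : ℂ),
      (∀ k : Fin d → Fin N, groverF (waveVector k) u a ≠ 0) →
      ((1 - u ^ 2) ^ (d - 1) * Complex.exp (1 / (N : ℂ) ^ d *
          ∑ k : Fin d → Fin N, Complex.log (groverF (waveVector k) u a))) ^ (N ^ d)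
        = walkDet N (flipFlop (generalizedGrover (CoinIdx d) a)) u) ∧
    ∀ u ∈ zetaDomain d a,
      -- the zeta function on finite tori
      (∀ (N : ℕ) [NeZero N],
        walkDet N (flipFlop (generalizedGrover (CoinIdx d) a)) u ≠ 0 ∧
        (∀ k : Fin d → Fin N, groverF (waveVector k) u a ≠ 0) ∧
        (walkZeta N (flipFlop (generalizedGrover (CoinIdx d) a)) u)⁻¹
          = (1 - u ^ 2) ^ (d - 1) * Complex.exp (1 / (N : ℂ) ^ d *
              ∑ k : Fin d → Fin N, Complex.log (groverF (waveVector k) u a))) ∧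
      -- the limit
      (∀ θ : Fin d → ℝ, groverF θ u a ≠ 0) ∧
      MeasureTheory.Integrable (fun θ : Fin d → ℝ => Complex.log (groverF θ u a))
        (uniformAngle d) ∧
      Filter.Tendsto
        (fun N : ℕ+ =>
          (walkZeta (N : ℕ) (flipFlop (generalizedGrover (CoinIdx d) a)) u)⁻¹)
        Filter.atTop
        (nhds ((1 - u ^ 2) ^ (d - 1) * Complex.exp
          (∫ θ : Fin d → ℝ, Complex.log (groverF θ u a) ∂(uniformAngle d)))) := by

  refine ⟨fun N _ u h => grover_root_pow_eq_walkDet hd a N u h, fun u hu => ⟨fun N _ =>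
    ⟨walkDet_grover_ne_zero hd ha hu N,
      fun k => Complex.slitPlane_ne_zero (groverF_mem_slitPlane hd ha hu _),
      walkZeta_grover_inv hd ha hu N⟩,
    fun θ => Complex.slitPlane_ne_zero (groverF_mem_slitPlane hd ha hu θ),
    integrable_uniformAngle (continuous_log_groverF hd ha hu), ?_⟩⟩
  simp only [walkZeta_grover_inv hd ha hu]
  exact ((Complex.continuous_exp.tendsto _).comp
    (tendsto_riemann_sum_uniformAngle (continuous_log_groverF hd ha hu))).const_mul _
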